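/- Let $m_1,m_2,n,r\ge 1$ be integers with $r\le n$, and let $A\in\mathbb R^{m_1\times n}$, $B\in\mathbb R^{m_2\times n}$. For $D\in\mathbb R^{p\times n}$ put $$H_D=\frac1p\left(\Big[\frac1r\sum_{i=1}^r\sigma_i^2(D)\Big]I_n-D^TD\right)\in\mathbb R^{n\times n},$$ where $\sigma_i(D)$ is the $i$-th largest singular value of $D$ (with $\sigma_i(D)=0$ for $i>\min\{p,n\}$). For $t\in[0,1]$ let $H(t)=tH_A+(1-t)H_B$ and $$\phi(t)=\sum_{i=1}^r\lambda_i(H(t)),$$ where $\lambda_i(\cdot)$ denotes the $i$-th smallest eigenvalue of a symmetric matrix, counted with multiplicity. Then $\phi$ is continuous on $[0,1]$, concave on $[0,1]$, and piecewise smooth on $[0,1]$, i.e. there are finitely many points $0=t_0<t_1<\dots<t_k=1$ such that the restriction of $\phi$ to each closed interval $[t_{j-1},t_j]$ is infinitely differentiable (with one-sided derivatives at the end points). -/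

import Mathlib

namespace FairPCA

/-- The singular value `σ_{i+1}(D)` of a real matrix: `singularValue D 0` is the largest one. Values
with index `i ≥ min p n` are zero. -/
noncomputable def singularValue {p n : ℕ} (D : Matrix (Fin p) (Fin n) ℝ) (i : ℕ) : ℝ :=
  (Matrix.toLpLin 2 2 D).singularValues i

/-- The matrix `H_D = (1/p) ([(1/r) ∑_{i ≤ r} σ_i(D)²] I_n - Dᵀ D)` of a data matrix `D` with
`p` rows, for the target dimension `r`. -/
noncomputable def lossMatrix {p n : ℕ} (r : ℕ) (D : Matrix (Fin p) (Fin n) ℝ) :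
    Matrix (Fin n) (Fin n) ℝ :=
  (1 / (p : ℝ)) •
    (((1 / (r : ℝ)) * ∑ i ∈ Finset.range r, singularValue D i ^ 2) •
        (1 : Matrix (Fin n) (Fin n) ℝ) - D.transpose * D)

/-- The matrix function `H(t) = t H_A + (1 - t) H_B`. -/
noncomputable def matrixFamily {m₁ m₂ n : ℕ} (r : ℕ) (A : Matrix (Fin m₁) (Fin n) ℝ)
    (B : Matrix (Fin m₂) (Fin n) ℝ) (t : ℝ) : Matrix (Fin n) (Fin n) ℝ :=
  t • lossMatrix r A + (1 - t) • lossMatrix r B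

theorem lossMatrix_isHermitian {p n : ℕ} (r : ℕ) (D : Matrix (Fin p) (Fin n) ℝ) :
    (lossMatrix r D).IsHermitian := by
  unfold lossMatrix
  simp [Matrix.IsHermitian, Matrix.conjTranspose_eq_transpose_of_trivial]

theorem matrixFamily_isHermitian {m₁ m₂ n : ℕ} (r : ℕ) (A : Matrix (Fin m₁) (Fin n) ℝ)
    (B : Matrix (Fin m₂) (Fin n) ℝ) (t : ℝ) : (matrixFamily r A B t).IsHermitian := by
  unfold matrixFamily
  have hA : (lossMatrix r A).transpose = lossMatrix r A := lossMatrix_isHermitian r A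
  have hB : (lossMatrix r B).transpose = lossMatrix r B := lossMatrix_isHermitian r B
  simp [Matrix.IsHermitian, hA, hB]

/-- The eigenvalue `λ_{i+1}(M)` of a real symmetric matrix, counted with multiplicity in
nondecreasing order: `eigenvalueAsc hM 0` is the smallest one. (`eigenvalues₀` lists them in
nonincreasing order.) -/
noncomputable def eigenvalueAsc {n : ℕ} {M : Matrix (Fin n) (Fin n) ℝ} (hM : M.IsHermitian)
    (i : Fin n) : ℝ :=
  hM.eigenvalues₀ (Fin.cast (Fintype.card_fin n).symm i.rev)

/-- The eigenvalue function `φ(t) = ∑_{i ≤ r} λ_i(H(t))`, the sum of the `r` smallest eigenvalues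
of `H(t)`. -/
noncomputable def phi {m₁ m₂ n r : ℕ} (hrn : r ≤ n) (A : Matrix (Fin m₁) (Fin n) ℝ)
    (B : Matrix (Fin m₂) (Fin n) ℝ) (t : ℝ) : ℝ :=
  ∑ i : Fin r, eigenvalueAsc (matrixFamily_isHermitian r A B t) (Fin.castLE hrn i)

/-- `f` is piecewise smooth on `[a, b]`: there are finitely many points
`a = p 0 < p 1 < ⋯ < p k = b` such that the restriction of `f` to each closed piece
`[p i, p (i+1)]` is infinitely differentiable (one-sidedly at the end points). -/
def PiecewiseSmoothOn (f : ℝ → ℝ) (a b : ℝ) : Prop :=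
  ∃ (k : ℕ) (p : Fin (k + 1) → ℝ), StrictMono p ∧ p 0 = a ∧ p (Fin.last k) = b ∧
    ∀ i : Fin k, ContDiffOn ℝ ((⊤ : ℕ∞) : WithTop ℕ∞) f (Set.Icc (p i.castSucc) (p i.succ))

end FairPCA

/-! By Ky Fan, the sum of the `r` smallest eigenvalues of `H` is the minimum of `∑ ⟨v_j, H v_j⟩`
over orthonormal `r`-frames. As `H(t)` is affine in `t`, `φ` is a minimum of affine functions, so it
is concave on all of `ℝ` and therefore continuous.

Piecewise smoothness rests on Rellich's theorem, `Polynomial.hasAnalyticRoots`: near each `t₀` the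
eigenvalues are, up to order, `n` analytic functions. Thus `φ` is locally the minimum of the sums of
`r` of them. Finitely many analytic germs are totally ordered on each side of `t₀`, so `φ` agrees
there with a single analytic function; a supremum argument then leaves finitely many pieces.

Rellich's theorem is proved by induction on the degree. Shift the roots to have sum zero. Their sum
of squares is then analytic and nonnegative: either it vanishes near `t₀`, and so do all roots, or
it has even order `2k`. In the latter case the roots are `O(|t - t₀|^k)`; dividing them by `(t -
t₀)^k` leaves a family with at least two distinct roots at `t₀`. There it splits into coprime
factors, and the inverse function theorem extends this splitting to nearby `t`. -/

open Polynomial Filter Topology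

/-- A one-parameter family of real polynomials all of whose coefficients are analytic at `t₀`. -/
def AnalyticCoeffs (p : ℝ → ℝ[X]) (t₀ : ℝ) : Prop :=
  ∀ k, AnalyticAt ℝ (fun t => (p t).coeff k) t₀

/-! ### Algebra of families with analytic coefficients -/

namespace AnalyticCoeffs

variable {p q : ℝ → ℝ[X]} {t₀ : ℝ}

theorem const (P : ℝ[X]) : AnalyticCoeffs (fun _ => P) t₀ := fun _ => analyticAt_const

theorem C {f : ℝ → ℝ} (hf : AnalyticAt ℝ f t₀) : AnalyticCoeffs (fun t => C (f t)) t₀ := by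
  intro k
  rcases Nat.eq_zero_or_pos k with rfl | hk
  · simpa using hf
  · simpa [coeff_C, hk.ne'] using analyticAt_const

theorem add (hp : AnalyticCoeffs p t₀) (hq : AnalyticCoeffs q t₀) :
    AnalyticCoeffs (fun t => p t + q t) t₀ := fun k => by
  simpa using (hp k).fun_add (hq k)

theorem sub (hp : AnalyticCoeffs p t₀) (hq : AnalyticCoeffs q t₀) :
    AnalyticCoeffs (fun t => p t - q t) t₀ := fun k => by
  simpa using (hp k).fun_sub (hq k)

theorem mul (hp : AnalyticCoeffs p t₀) (hq : AnalyticCoeffs q t₀) :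
    AnalyticCoeffs (fun t => p t * q t) t₀ := fun k => by
  simp only [coeff_mul]
  exact Finset.analyticAt_fun_sum _ fun i _ => (hp _).fun_mul (hq _)

theorem pow (hp : AnalyticCoeffs p t₀) (n : ℕ) : AnalyticCoeffs (fun t => p t ^ n) t₀ := by
  induction n with
  | zero => simpa using const 1
  | succ n ih => simpa only [pow_succ] using ih.mul hp

theorem sum {ι : Type*} (s : Finset ι) {f : ι → ℝ → ℝ[X]}
    (h : ∀ i ∈ s, AnalyticCoeffs (f i) t₀) : AnalyticCoeffs (fun t => ∑ i ∈ s, f i t) t₀ :=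
  fun k => by
    simp only [finsetSum_coeff]
    exact Finset.analyticAt_fun_sum _ fun i hi => h i hi k

theorem prod {ι : Type*} (s : Finset ι) {f : ι → ℝ → ℝ[X]}
    (h : ∀ i ∈ s, AnalyticCoeffs (f i) t₀) : AnalyticCoeffs (fun t => ∏ i ∈ s, f i t) t₀ := by
  classical
  induction s using Finset.induction_on with
  | empty => simpa using const 1
  | insert a s ha ih =>
    simp only [Finset.prod_insert ha]
    exact (h a (by simp)).mul (ih fun i hi => h i (by simp [hi]))

end AnalyticCoeffs

/-! ### Lifting coprime factorizations by the inverse function theorem -/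

namespace Polynomial

/-- The monic polynomial of degree `n` with prescribed lower coefficients. -/
noncomputable def monicOfFn (n : ℕ) (v : Fin n → ℝ) : ℝ[X] := X ^ n + ofFn n v

theorem monic_monicOfFn (n : ℕ) (v : Fin n → ℝ) : (monicOfFn n v).Monic :=
  monic_X_pow_add (ofFn_degree_lt v)

theorem natDegree_monicOfFn (n : ℕ) (v : Fin n → ℝ) : (monicOfFn n v).natDegree = n := by
  apply natDegree_eq_of_degree_eq_some
  rw [monicOfFn, degree_add_eq_left_of_degree_lt, degree_X_pow]
  simpa using ofFn_degree_lt v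

theorem coeff_monicOfFn {n i : ℕ} (v : Fin n → ℝ) (hi : i < n) :
    (monicOfFn n v).coeff i = v ⟨i, hi⟩ := by
  simp [monicOfFn, coeff_X_pow, hi, hi.ne]

theorem toFn_apply {n : ℕ} (p : ℝ[X]) (i : Fin n) : toFn n p i = p.coeff i := rfl

theorem toFn_monicOfFn (n : ℕ) (v : Fin n → ℝ) : toFn n (monicOfFn n v) = v := by
  ext i
  exact coeff_monicOfFn v i.2

theorem Monic.eq_of_toFn_eq {n : ℕ} {p q : ℝ[X]} (hp : p.Monic) (hq : q.Monic)
    (hpn : p.natDegree = n) (hqn : q.natDegree = n) (h : toFn n p = toFn n q) : p = q := by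
  ext i
  rcases lt_trichotomy i n with hi | rfl | hi
  · exact congrFun h ⟨i, hi⟩
  · rw [← hpn, hp.coeff_natDegree, hpn, ← hqn, hq.coeff_natDegree]
  · rw [coeff_eq_zero_of_natDegree_lt (hpn ▸ hi), coeff_eq_zero_of_natDegree_lt (hqn ▸ hi)]

theorem Monic.eq_monicOfFn {n : ℕ} {p : ℝ[X]} (hp : p.Monic) (hpn : p.natDegree = n) :
    p = monicOfFn n (toFn n p) :=
  hp.eq_of_toFn_eq (monic_monicOfFn _ _) hpn (natDegree_monicOfFn _ _) (toFn_monicOfFn _ _).symm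

theorem analyticCoeffs_monicOfFn {n : ℕ} {v : ℝ → Fin n → ℝ} {t₀ : ℝ}
    (hv : ∀ i, AnalyticAt ℝ (fun t => v t i) t₀) :
    AnalyticCoeffs (fun t => monicOfFn n (v t)) t₀ := by
  intro k
  by_cases hk : k < n
  · simpa only [coeff_monicOfFn _ hk] using hv _
  · have : (fun t => (monicOfFn n (v t)).coeff k) = fun _ => (X ^ n : ℝ[X]).coeff k := by
      ext t
      simp [monicOfFn, not_lt.mp hk]
    rw [this]
    exact analyticAt_const

/-- Multiplication of monic polynomials of degrees `k` and `m`, in terms of lower coefficients. -/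
noncomputable def monicMul (k m : ℕ) (x : (Fin k → ℝ) × (Fin m → ℝ)) : Fin (k + m) → ℝ :=
  toFn (k + m) (monicOfFn k x.1 * monicOfFn m x.2)

/-- The bilinear map sending coefficient vectors to the coefficients of the product. -/
noncomputable def mulFn (k m : ℕ) :
    (Fin k → ℝ) →ₗ[ℝ] (Fin m → ℝ) →ₗ[ℝ] (Fin (k + m) → ℝ) :=
  ((LinearMap.mul ℝ ℝ[X]).compl₁₂ (ofFn k) (ofFn m)).compr₂ (toFn (k + m))

/-- The differential of `monicMul` at `(F, G)`. -/
noncomputable def bezoutMap (k m : ℕ) (F G : ℝ[X]) :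
    (Fin k → ℝ) × (Fin m → ℝ) →ₗ[ℝ] (Fin (k + m) → ℝ) :=
  (toFn (k + m)) ∘ₗ
    LinearMap.coprod (LinearMap.mulRight ℝ G ∘ₗ ofFn k) (LinearMap.mulLeft ℝ F ∘ₗ ofFn m)

theorem bezoutMap_apply (k m : ℕ) (F G : ℝ[X]) (x : (Fin k → ℝ) × (Fin m → ℝ)) :
    bezoutMap k m F G x = toFn (k + m) (ofFn k x.1 * G + F * ofFn m x.2) := by
  simp [bezoutMap]

/-- Splits the product map into constant, linear and bilinear parts, from which smoothness and the
differential can be read off. -/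
theorem monicMul_eq (k m : ℕ) (x : (Fin k → ℝ) × (Fin m → ℝ)) :
    monicMul k m x = toFn (k + m) (X ^ (k + m)) + bezoutMap k m (X ^ k) (X ^ m) x
      + mulFn k m x.1 x.2 := by
  simp only [monicMul, bezoutMap_apply, mulFn, monicOfFn, LinearMap.compr₂_apply,
    LinearMap.compl₁₂_apply, LinearMap.mul_apply', ← map_add]
  congr 1
  ring

theorem contDiff_monicMul (k m : ℕ) {n : WithTop ℕ∞} : ContDiff ℝ n (monicMul k m) := by
  have : monicMul k m = fun x => toFn (k + m) (X ^ (k + m)) +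
      (bezoutMap k m (X ^ k) (X ^ m)).toContinuousLinearMap x
      + (mulFn k m).toContinuousBilinearMap x.1 x.2 := by
    ext1 x
    exact monicMul_eq k m x
  rw [this]
  fun_prop

theorem hasFDerivAt_monicMul (k m : ℕ) (x : (Fin k → ℝ) × (Fin m → ℝ)) :
    HasFDerivAt (monicMul k m)
      (bezoutMap k m (monicOfFn k x.1) (monicOfFn m x.2)).toContinuousLinearMap x := by
  have h1 : monicMul k m = fun x => toFn (k + m) (X ^ (k + m)) +
      (bezoutMap k m (X ^ k) (X ^ m)).toContinuousLinearMap x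
      + (mulFn k m).toContinuousBilinearMap x.1 x.2 := by
    ext1 x
    exact monicMul_eq k m x
  have h2 := (((bezoutMap k m (X ^ k) (X ^ m)).toContinuousLinearMap.hasFDerivAt (x := x)).const_add
    (toFn (k + m) (X ^ (k + m)))).add
    (((mulFn k m).toContinuousBilinearMap).isBoundedBilinearMap.hasFDerivAt x)
  rw [h1]
  refine h2.congr_fderiv ?_
  apply ContinuousLinearMap.ext
  intro y
  change bezoutMap k m (X ^ k) (X ^ m) y + (mulFn k m x.1 y.2 + mulFn k m y.1 x.2)
    = bezoutMap k m (monicOfFn k x.1) (monicOfFn m x.2) y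
  simp only [bezoutMap_apply, mulFn, monicOfFn, LinearMap.compr₂_apply,
    LinearMap.compl₁₂_apply, LinearMap.mul_apply', ← map_add]
  congr 1
  ring

/-- If `u G + F v = 0`, then `F` divides `u` by coprimality, and `deg u < deg F` forces `u = 0`,
then `v = 0`. The sum has degree below `k + m`, so `toFn` loses no coefficient. -/
theorem bezoutMap_injective {k m : ℕ} {F G : ℝ[X]} (hF : F.Monic) (hG : G.Monic)
    (hFk : F.natDegree = k) (hGm : G.natDegree = m) (h : IsCoprime F G) :
    Function.Injective (bezoutMap k m F G) := by
  rw [← LinearMap.ker_eq_bot, LinearMap.ker_eq_bot']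
  rintro ⟨u, v⟩ huv
  rw [bezoutMap_apply] at huv
  have dF : F.degree = k := by rw [degree_eq_natDegree hF.ne_zero, hFk]
  have dG : G.degree = m := by rw [degree_eq_natDegree hG.ne_zero, hGm]
  have hdeg : (ofFn k u * G + F * ofFn m v).degree < (k + m : ℕ) := by
    refine (degree_add_le _ _).trans_lt (max_lt ?_ ?_)
    · rw [degree_mul, dG, Nat.cast_add]
      exact WithBot.add_lt_add_right (by simp) (ofFn_degree_lt u)
    · rw [degree_mul, dF, Nat.cast_add]
      exact WithBot.add_lt_add_left (by simp) (ofFn_degree_lt v)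
  have hz : ofFn k u * G + F * ofFn m v = 0 := by
    ext i
    by_cases hi : i < k + m
    · exact congrFun huv ⟨i, hi⟩
    · rw [coeff_eq_zero_of_degree_lt (hdeg.trans_le (by exact_mod_cast not_lt.mp hi)), coeff_zero]
  have hdvd : F ∣ ofFn k u := by
    refine h.dvd_of_dvd_mul_right ⟨-ofFn m v, ?_⟩
    linear_combination hz
  have hu : ofFn k u = 0 := by
    by_contra hne
    exact absurd (degree_le_of_dvd hdvd hne) (by rw [dF]; exact not_le.mpr (ofFn_degree_lt u))
  have hv : ofFn m v = 0 := by
    rw [hu, zero_mul, zero_add] at hz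
    exact (mul_eq_zero.mp hz).resolve_left hF.ne_zero
  have hu' : u = 0 := injective_ofFn k (by rw [hu, map_zero])
  have hv' : v = 0 := injective_ofFn m (by rw [hv, map_zero])
  rw [hu', hv', Prod.mk_zero_zero]

/-- A coprime factorization of one member of an analytic family of monic polynomials extends to
an analytic factorization of the family. -/
theorem exists_analyticCoeffs_factorization {p : ℝ → ℝ[X]} {t₀ : ℝ} {k m : ℕ} {F G : ℝ[X]}
    (hp : AnalyticCoeffs p t₀) (hmon : ∀ t, (p t).Monic) (hdeg : ∀ t, (p t).natDegree = k + m)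
    (hF : F.Monic) (hG : G.Monic) (hFk : F.natDegree = k) (hGm : G.natDegree = m)
    (h : IsCoprime F G) (hFG : p t₀ = F * G) :
    ∃ f g : ℝ → ℝ[X], AnalyticCoeffs f t₀ ∧ AnalyticCoeffs g t₀ ∧
      (∀ t, (f t).Monic) ∧ (∀ t, (g t).Monic) ∧
      (∀ t, (f t).natDegree = k) ∧ (∀ t, (g t).natDegree = m) ∧
      ∀ᶠ t in 𝓝 t₀, p t = f t * g t := by
  set x : (Fin k → ℝ) × (Fin m → ℝ) := (toFn k F, toFn m G) with hx
  have hxF : monicOfFn k x.1 = F := (hF.eq_monicOfFn hFk).symm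
  have hxG : monicOfFn m x.2 = G := (hG.eq_monicOfFn hGm).symm
  let e : ((Fin k → ℝ) × (Fin m → ℝ)) ≃L[ℝ] (Fin (k + m) → ℝ) :=
    (LinearMap.linearEquivOfInjective (bezoutMap k m F G)
      (bezoutMap_injective hF hG hFk hGm h) (by simp)).toContinuousLinearEquiv
  have hderiv : HasFDerivAt (monicMul k m) (e : _ →L[ℝ] (Fin (k + m) → ℝ)) x := by
    have := hasFDerivAt_monicMul k m x
    rw [hxF, hxG] at this
    exact this
  -- Here `⊤` is the analytic class, above `∞`, so the local inverse is analytic.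
  have hcd : ContDiffAt ℝ ⊤ (monicMul k m) x := (contDiff_monicMul k m).contDiffAt
  have hxp : monicMul k m x = toFn (k + m) (p t₀) := by rw [monicMul, hxF, hxG, hFG]
  have hv : AnalyticAt ℝ (fun t => toFn (k + m) (p t)) t₀ :=
    analyticAt_pi_iff.mpr fun i => hp i
  let inv := hcd.localInverse hderiv (by simp)
  have hinv : AnalyticAt ℝ inv (toFn (k + m) (p t₀)) := by
    rw [← hxp]
    exact (hcd.to_localInverse hderiv (by simp)).analyticAt
  have hgv : AnalyticAt ℝ (fun t => inv (toFn (k + m) (p t))) t₀ :=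
    hinv.fun_comp (f := fun t => toFn (k + m) (p t)) hv
  have hright : ∀ᶠ y in 𝓝 (toFn (k + m) (p t₀)), monicMul k m (inv y) = y := by
    rw [← hxp]
    exact (hcd.hasStrictFDerivAt' hderiv (by simp)).eventually_right_inverse
  refine ⟨fun t => monicOfFn k (inv (toFn (k + m) (p t))).1,
    fun t => monicOfFn m (inv (toFn (k + m) (p t))).2, ?_, ?_, fun _ => monic_monicOfFn _ _,
    fun _ => monic_monicOfFn _ _, fun _ => natDegree_monicOfFn _ _,
    fun _ => natDegree_monicOfFn _ _, ?_⟩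
  · refine analyticCoeffs_monicOfFn fun i => ?_
    exact analyticAt_pi_iff.mp (analyticAt_fst.fun_comp hgv) i
  · refine analyticCoeffs_monicOfFn fun i => ?_
    exact analyticAt_pi_iff.mp (analyticAt_snd.fun_comp hgv) i
  · filter_upwards [hv.continuousAt.eventually hright] with t ht
    refine (hmon t).eq_of_toFn_eq ((monic_monicOfFn _ _).mul (monic_monicOfFn _ _)) (hdeg t) ?_
      ht.symm
    rw [(monic_monicOfFn _ _).natDegree_mul (monic_monicOfFn _ _), natDegree_monicOfFn,
      natDegree_monicOfFn]

end Polynomial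

/-! ### Real-rooted polynomials -/

theorem Multiset.sum_map_sq_eq (s : Multiset ℝ) :
    (s.map (· ^ 2)).sum = s.sum ^ 2 - 2 * s.esymm 2 := by
  induction s using Multiset.induction_on with
  | empty => simp [Multiset.esymm, Multiset.powersetCard_zero_right]
  | cons a s ih =>
    have h : (a ::ₘ s).esymm 2 = s.esymm 2 + a * s.sum := by
      rw [Multiset.esymm, Multiset.powersetCard_cons, Multiset.powersetCard_one]
      simpa [Multiset.esymm, Multiset.map_map] using Multiset.sum_map_mul_left (s := s) (f := id)
    rw [Multiset.map_cons, Multiset.sum_cons, ih, h, Multiset.sum_cons]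
    ring

namespace Polynomial

theorem Splits.sum_sq_roots {p : ℝ[X]} (hs : p.Splits) (hm : p.Monic) {n : ℕ}
    (hn : p.natDegree = n + 2) :
    (p.roots.map (· ^ 2)).sum = p.coeff (n + 1) ^ 2 - 2 * p.coeff n := by
  have h1 := coeff_eq_esymm_roots_of_splits hs (k := n + 1) (by omega)
  have h2 := coeff_eq_esymm_roots_of_splits hs (k := n) (by omega)
  rw [hn, hm.leadingCoeff, show n + 2 - (n + 1) = 1 by omega] at h1
  rw [hn, hm.leadingCoeff, show n + 2 - n = 2 by omega] at h2
  have h3 : p.roots.esymm 1 = p.roots.sum := by simp [Multiset.esymm, Multiset.powersetCard_one]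
  rw [Multiset.sum_map_sq_eq, h1, h2, h3]
  ring

theorem Splits.sq_le_of_mem_roots {p : ℝ[X]} (hs : p.Splits) (hm : p.Monic) {n : ℕ}
    (hn : p.natDegree = n + 2) {x : ℝ} (hx : x ∈ p.roots) :
    x ^ 2 ≤ p.coeff (n + 1) ^ 2 - 2 * p.coeff n := by
  rw [← hs.sum_sq_roots hm hn]
  refine Multiset.single_le_sum ?_ _ (Multiset.mem_map_of_mem _ hx)
  intro y hy
  obtain ⟨z, -, rfl⟩ := Multiset.mem_map.mp hy
  positivity

/-- Real-rootedness is a closed condition on monic polynomials of fixed degree. -/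
theorem splits_of_eventually_splits {q : ℝ → ℝ[X]} {t₀ : ℝ} {n : ℕ}
    (hc : ∀ k, ContinuousAt (fun t => (q t).coeff k) t₀) (hm : ∀ t, (q t).Monic)
    (hn : ∀ t, (q t).natDegree = n + 2) (hs : ∀ᶠ t in 𝓝[≠] t₀, (q t).Splits) :
    (q t₀).Splits := by
  -- Near `t₀` the squares of the roots are less than `M ≤ (M + 1) ^ 2`, so all roots lie in `[-(M +
  -- 1), M + 1]`.
  set M : ℝ := (q t₀).coeff (n + 1) ^ 2 - 2 * (q t₀).coeff n + 1 with hM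
  have hb : ∀ᶠ t in 𝓝[≠] t₀, (q t).coeff (n + 1) ^ 2 - 2 * (q t).coeff n < M := by
    have : ContinuousAt (fun t => (q t).coeff (n + 1) ^ 2 - 2 * (q t).coeff n) t₀ :=
      ((hc _).pow 2).sub (continuousAt_const.mul (hc _))
    exact (this.eventually (gt_mem_nhds (by rw [hM]; linarith))).filter_mono nhdsWithin_le_nhds
  let Φ : (Fin (n + 2) → ℝ) → Fin (n + 2) → ℝ := fun x => toFn (n + 2) (∏ i, (X - C (x i)))
  have hΦ : Continuous Φ := by
    refine continuous_pi fun k => ?_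
    have h : ∀ (s : Finset (Fin (n + 2))) (k : ℕ),
        Continuous fun x : Fin (n + 2) → ℝ => (∏ i ∈ s, (X - C (x i))).coeff k := by
      intro s
      induction s using Finset.induction_on with
      | empty => intro k; simpa using continuous_const
      | insert a s ha ih =>
        intro k
        simp only [Finset.prod_insert ha, sub_mul, coeff_sub, coeff_C_mul]
        refine Continuous.sub ?_ ((continuous_apply a).mul (ih k))
        cases k with
        | zero => simpa using continuous_const
        | succ k => simpa only [coeff_X_mul] using ih k
    exact h Finset.univ k
  -- Coefficient vectors of polynomials with all roots in this box form a compact, hence closed,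
  -- set, which therefore contains the limit at `t₀`.
  have hK : IsCompact (Φ '' Set.Icc (fun _ => -(M + 1)) (fun _ => M + 1)) :=
    isCompact_Icc.image hΦ
  have hmem : ∀ᶠ t in 𝓝[≠] t₀,
      toFn (n + 2) (q t) ∈ Φ '' Set.Icc (fun _ => -(M + 1)) (fun _ => M + 1) := by
    filter_upwards [hs, hb] with t ht hbt
    have hcard : (q t).roots.card = n + 2 := by rw [← ht.natDegree_eq_card_roots, hn]
    have hl : (q t).roots.toList.length = n + 2 := by rw [Multiset.length_toList, hcard]
    refine ⟨fun i => (q t).roots.toList.get (i.cast hl.symm), ?_, ?_⟩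
    · have hx : ∀ i : Fin (n + 2), |(q t).roots.toList.get (i.cast hl.symm)| ≤ M + 1 := by
        intro i
        have hr : (q t).roots.toList.get (i.cast hl.symm) ∈ (q t).roots :=
          Multiset.mem_toList.mp (List.get_mem _ _)
        have h1 := ht.sq_le_of_mem_roots (hm t) (hn t) hr
        have hM0 : 0 < M := lt_of_le_of_lt ((sq_nonneg _).trans h1) hbt
        refine abs_le_of_sq_le_sq ?_ (by linarith)
        nlinarith
      exact ⟨fun i => (abs_le.mp (hx i)).1, fun i => (abs_le.mp (hx i)).2⟩
    · simp only [Φ]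
      congr 1
      conv_rhs => rw [ht.eq_prod_roots_of_monic (hm t), ← Multiset.coe_toList (q t).roots,
        Multiset.map_coe, Multiset.prod_coe]
      rw [← List.prod_ofFn]
      congr 1
      apply List.ext_get
      · simp [hcard]
      · intro i h1 h2
        simp [-List.ofFn_succ]
  have hlim : Tendsto (fun t => toFn (n + 2) (q t)) (𝓝[≠] t₀) (𝓝 (toFn (n + 2) (q t₀))) :=
    tendsto_pi_nhds.mpr fun i => (hc i).tendsto.mono_left nhdsWithin_le_nhds
  obtain ⟨x, -, hx⟩ := hK.isClosed.mem_of_tendsto hlim hmem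
  have : q t₀ = ∏ i, (X - C (x i)) := by
    refine (hm t₀).eq_of_toFn_eq (monic_prod_X_sub_C _ _) (hn t₀) ?_ hx.symm
    simp
  rw [this]
  exact Splits.prod fun i _ => Splits.X_sub_C _

/-- Split off the full power of `X - a` at one root `a`. If nothing else remained, the zero sum of
roots would give `a = 0` and `P = X ^ (n + 2)`, against `h0`. -/
theorem exists_isCoprime_factorization {P : ℝ[X]} (hs : P.Splits) (hm : P.Monic) {n : ℕ}
    (hn : P.natDegree = n + 2) (h1 : P.coeff (n + 1) = 0) (h0 : P.coeff n ≠ 0) :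
    ∃ F G : ℝ[X], F.Monic ∧ G.Monic ∧ IsCoprime F G ∧ P = F * G ∧
      F.natDegree < n + 2 ∧ G.natDegree < n + 2 := by
  obtain ⟨a, ha⟩ := hs.exists_eval_eq_zero
    (by rw [degree_eq_natDegree hm.ne_zero, hn]; exact_mod_cast Nat.succ_ne_zero (n + 1))
  obtain ⟨G, hG, hnd⟩ := exists_eq_pow_rootMultiplicity_mul_and_not_dvd P hm.ne_zero a
  have hpos : 0 < P.rootMultiplicity a := (rootMultiplicity_pos hm.ne_zero).mpr ha
  set k := P.rootMultiplicity a with hk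
  have hF : ((X - C a) ^ k).Monic := (monic_X_sub_C a).pow k
  have hGm : G.Monic := hF.of_mul_monic_left (hG ▸ hm)
  have hdeg : k + G.natDegree = n + 2 := by
    have := congrArg natDegree hG
    rw [hn, hF.natDegree_mul hGm, (monic_X_sub_C a).natDegree_pow, natDegree_X_sub_C] at this
    omega
  have hG0 : G.natDegree ≠ 0 := by
    intro h
    have hG1 : G = 1 := hGm.natDegree_eq_zero.mp h
    have hkn : k = n + 2 := by omega
    rw [hG1, mul_one, hkn] at hG
    have hr : P.roots = Multiset.replicate (n + 2) a := by
      rw [hG, roots_pow, roots_X_sub_C, Multiset.nsmul_singleton]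
    have hnc := hs.nextCoeff_eq_neg_sum_roots_of_monic hm
    rw [nextCoeff_of_natDegree_pos (by omega), hn, show n + 2 - 1 = n + 1 by omega, h1, hr,
      Multiset.sum_replicate, nsmul_eq_mul] at hnc
    have hn2 : ((n + 2 : ℕ) : ℝ) ≠ 0 := by positivity
    have ha0 : a = 0 := by
      rcases mul_eq_zero.mp (neg_eq_zero.mp hnc.symm) with h | h
      · exact absurd h hn2
      · exact h
    apply h0
    rw [hG, ha0, C_0, sub_zero, coeff_X_pow, if_neg (by omega)]
  refine ⟨(X - C a) ^ k, G, hF, hGm, ?_, hG, ?_, by omega⟩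
  · exact IsCoprime.pow_left (((irreducible_X_sub_C a).coprime_iff_not_dvd).mpr hnd)
  · rw [(monic_X_sub_C a).natDegree_pow, natDegree_X_sub_C]
    omega

theorem scaleRoots_multiset_prod_X_sub_C (L : Multiset ℝ) (s : ℝ) :
    ((L.map fun x => X - C x).prod).scaleRoots s = (L.map fun x => X - C (x * s)).prod := by
  induction L using Multiset.induction_on with
  | empty => simp
  | cons a L ih =>
    simp only [Multiset.map_cons, Multiset.prod_cons]
    rw [mul_scaleRoots_of_noZeroDivisors, ih, X_sub_C_scaleRoots]

end Polynomial

/-! ### Vanishing orders of analytic germs -/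

/-- Were the order `m` less than `N`, the cofactor of `(t - t₀) ^ m` would be `O(|t - t₀| ^ (N -
m))` and vanish at `t₀`. -/
theorem AnalyticAt.exists_eq_pow_mul_of_abs_le {f : ℝ → ℝ} {t₀ K : ℝ} {N : ℕ}
    (hf : AnalyticAt ℝ f t₀) (h : ∀ᶠ t in 𝓝 t₀, |f t| ≤ K * |t - t₀| ^ N) :
    ∃ g : ℝ → ℝ, AnalyticAt ℝ g t₀ ∧ ∀ᶠ t in 𝓝 t₀, f t = (t - t₀) ^ N * g t := by
  refine (natCast_le_analyticOrderAt hf).mp ?_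
  by_contra! hlt
  obtain ⟨m, hm⟩ := ENat.ne_top_iff_exists.mp (ne_top_of_lt hlt)
  obtain ⟨g, hg, hg0, hfg⟩ := hf.analyticOrderAt_eq_natCast.mp hm.symm
  have hmN : m < N := by rw [← hm] at hlt; exact_mod_cast hlt
  apply hg0
  have hle : ∀ᶠ t in 𝓝[≠] t₀, ‖g t‖ ≤ K * |t - t₀| ^ (N - m) := by
    filter_upwards [h.filter_mono nhdsWithin_le_nhds, hfg.filter_mono nhdsWithin_le_nhds,
      self_mem_nhdsWithin] with t h1 h2 h3
    have hpos : 0 < |t - t₀| := abs_pos.mpr (sub_ne_zero.mpr h3)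
    rw [h2, smul_eq_mul, abs_mul, abs_pow, ← Nat.sub_add_cancel hmN.le, pow_add] at h1
    rw [Real.norm_eq_abs]
    refine le_of_mul_le_mul_left ?_ (pow_pos hpos m)
    linarith
  have hlim : Tendsto (fun t => K * |t - t₀| ^ (N - m)) (𝓝[≠] t₀) (𝓝 0) := by
    have : Continuous fun t : ℝ => K * |t - t₀| ^ (N - m) := by fun_prop
    have h0 := this.tendsto t₀
    simp only [sub_self, abs_zero, zero_pow (Nat.sub_ne_zero_of_lt hmN), mul_zero] at h0
    exact h0.mono_left nhdsWithin_le_nhds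
  exact tendsto_nhds_unique (hg.continuousAt.tendsto.mono_left nhdsWithin_le_nhds)
    (squeeze_zero_norm' hle hlim)

/-- A nonnegative analytic germ that is not zero has even order and positive leading part. -/
theorem AnalyticAt.exists_eq_even_pow_mul_of_nonneg {f : ℝ → ℝ} {t₀ : ℝ}
    (hf : AnalyticAt ℝ f t₀) (h : ∀ᶠ t in 𝓝 t₀, 0 ≤ f t) (hne : ¬ ∀ᶠ t in 𝓝 t₀, f t = 0) :
    ∃ (k : ℕ) (g : ℝ → ℝ), AnalyticAt ℝ g t₀ ∧ 0 < g t₀ ∧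
      ∀ᶠ t in 𝓝 t₀, f t = (t - t₀) ^ (2 * k) * g t := by
  obtain ⟨m, g, hg, hg0, hfg⟩ := hf.exists_eventuallyEq_pow_smul_nonzero_iff.mpr hne
  have hright : 0 ≤ g t₀ := by
    have hlim : Tendsto g (𝓝[>] t₀) (𝓝 (g t₀)) :=
      hg.continuousAt.tendsto.mono_left nhdsWithin_le_nhds
    refine ge_of_tendsto hlim ?_
    filter_upwards [h.filter_mono nhdsWithin_le_nhds, hfg.filter_mono nhdsWithin_le_nhds,
      self_mem_nhdsWithin] with t h1 h2 h3
    rw [h2, smul_eq_mul] at h1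
    exact nonneg_of_mul_nonneg_right h1 (pow_pos (sub_pos.mpr h3) m)
  rcases Nat.even_or_odd m with he | ho
  · obtain ⟨k, rfl⟩ := he
    exact ⟨k, g, hg, lt_of_le_of_ne hright hg0.symm, by simpa [two_mul] using hfg⟩
  · exfalso
    have hleft : g t₀ ≤ 0 := by
      have hlim : Tendsto g (𝓝[<] t₀) (𝓝 (g t₀)) :=
        hg.continuousAt.tendsto.mono_left nhdsWithin_le_nhds
      refine le_of_tendsto hlim ?_
      filter_upwards [h.filter_mono nhdsWithin_le_nhds, hfg.filter_mono nhdsWithin_le_nhds,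
        self_mem_nhdsWithin] with t h1 h2 h3
      rw [h2, smul_eq_mul] at h1
      have h4 : t - t₀ < 0 := sub_neg.mpr h3
      have := ho.pow_neg h4
      by_contra! hpos
      exact absurd h1 (not_le.mpr (mul_neg_of_neg_of_pos this hpos))
    exact hg0 (le_antisymm hleft hright)

/-! ### Rellich's theorem for polynomials -/

theorem AnalyticCoeffs.taylor {p : ℝ → ℝ[X]} {t₀ : ℝ} {n : ℕ} {c : ℝ → ℝ}
    (hp : AnalyticCoeffs p t₀) (hn : ∀ t, (p t).natDegree = n) (hc : AnalyticAt ℝ c t₀) :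
    AnalyticCoeffs (fun t => Polynomial.taylor (c t) (p t)) t₀ := by
  -- The constant degree makes the range of summation independent of `t`.
  have h : (fun t => Polynomial.taylor (c t) (p t)) = fun t =>
      ∑ i ∈ Finset.range (n + 1), Polynomial.C ((p t).coeff i) * (X + Polynomial.C (c t)) ^ i := by
    ext1 t
    conv_lhs => rw [(p t).as_sum_range_C_mul_X_pow, hn t]
    simp [taylor_mul, taylor_C]
  rw [h]
  exact .sum _ fun i _ => (AnalyticCoeffs.C (hp i)).mul (((const X).add (.C hc)).pow i)

namespace Polynomial

theorem taylor_coeff_of_natDegree_eq_add_one {p : ℝ[X]} (hm : p.Monic) {n : ℕ}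
    (hn : p.natDegree = n + 1) (c : ℝ) :
    (taylor c p).coeff n = p.coeff n + (n + 1) * c := by
  have hlead : p.coeff (n + 1) = 1 := by rw [← hn]; exact hm
  have hd : (hasseDeriv n p).natDegree < 2 := by
    have := natDegree_hasseDeriv_le p n
    omega
  rw [taylor_coeff, eval_eq_sum_range' hd, Finset.sum_range_succ, Finset.sum_range_one]
  simp [hasseDeriv_coeff, add_comm 1 n, hlead]

theorem taylor_multiset_prod_X_sub_C (L : Multiset ℝ) (r : ℝ) :
    taylor r (L.map fun x => X - C x).prod = (L.map fun x => X - C (x - r)).prod := by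
  induction L using Multiset.induction_on with
  | empty => simp
  | cons a L ih =>
    simp only [Multiset.map_cons, Multiset.prod_cons]
    rw [taylor_mul, ih, map_sub, taylor_X, taylor_C, C_sub]
    ring

/-- The roots of the family `p` are near `t₀` given by analytic functions. -/
def HasAnalyticRoots (p : ℝ → ℝ[X]) (t₀ : ℝ) : Prop :=
  ∃ L : Multiset (ℝ → ℝ), (∀ f ∈ L, AnalyticAt ℝ f t₀) ∧
    ∀ᶠ t in 𝓝 t₀, p t = ((L.map fun f => f t).map fun x => X - C x).prod

theorem HasAnalyticRoots.of_taylor {p : ℝ → ℝ[X]} {t₀ : ℝ} {c : ℝ → ℝ}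
    (hc : AnalyticAt ℝ c t₀) (h : HasAnalyticRoots (fun t => taylor (c t) (p t)) t₀) :
    HasAnalyticRoots p t₀ := by
  obtain ⟨L, hL, hpL⟩ := h
  refine ⟨L.map fun f t => f t + c t, ?_, ?_⟩
  · intro f hf
    obtain ⟨g, hg, rfl⟩ := Multiset.mem_map.mp hf
    exact (hL g hg).fun_add hc
  · filter_upwards [hpL] with t ht
    have h := congrArg (taylor (-c t)) ht
    rw [taylor_taylor, neg_add_cancel, taylor_zero, taylor_multiset_prod_X_sub_C] at h
    rw [h]
    simp [Multiset.map_map, sub_neg_eq_add]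

theorem HasAnalyticRoots.of_scaleRoots {p q : ℝ → ℝ[X]} {t₀ : ℝ} {s : ℝ → ℝ}
    (hs : AnalyticAt ℝ s t₀) (h : HasAnalyticRoots q t₀)
    (hpq : ∀ᶠ t in 𝓝 t₀, p t = (q t).scaleRoots (s t)) : HasAnalyticRoots p t₀ := by
  obtain ⟨L, hL, hqL⟩ := h
  refine ⟨L.map fun f t => f t * s t, ?_, ?_⟩
  · intro f hf
    obtain ⟨g, hg, rfl⟩ := Multiset.mem_map.mp hf
    exact (hL g hg).fun_mul hs
  · filter_upwards [hqL, hpq] with t h1 h2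
    rw [h2, h1, scaleRoots_multiset_prod_X_sub_C]
    simp [Multiset.map_map]

theorem HasAnalyticRoots.of_mul {p f g : ℝ → ℝ[X]} {t₀ : ℝ} (hf : HasAnalyticRoots f t₀)
    (hg : HasAnalyticRoots g t₀) (hp : ∀ᶠ t in 𝓝 t₀, p t = f t * g t) :
    HasAnalyticRoots p t₀ := by
  obtain ⟨L, hL, hfL⟩ := hf
  obtain ⟨M, hM, hgM⟩ := hg
  refine ⟨L + M, ?_, ?_⟩
  · intro h hh
    rcases Multiset.mem_add.mp hh with h1 | h1
    · exact hL h h1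
    · exact hM h h1
  · filter_upwards [hfL, hgM, hp] with t h1 h2 h3
    rw [h3, h1, h2]
    simp

/-- A centered real-rooted analytic family is obtained, by scaling the roots with a power of
`t - t₀`, from a family whose value at `t₀` is not a power of a linear polynomial. -/
theorem exists_eq_scaleRoots {p : ℝ → ℝ[X]} {t₀ : ℝ} {n : ℕ} (hp : AnalyticCoeffs p t₀)
    (hm : ∀ t, (p t).Monic) (hn : ∀ t, (p t).natDegree = n + 2)
    (hs : ∀ᶠ t in 𝓝 t₀, (p t).Splits) (hc : ∀ t, (p t).coeff (n + 1) = 0)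
    (hne : ¬ ∀ᶠ t in 𝓝 t₀, (p t).coeff n = 0) :
    ∃ (k : ℕ) (q : ℝ → ℝ[X]), AnalyticCoeffs q t₀ ∧ (∀ t, (q t).Monic) ∧
      (∀ t, (q t).natDegree = n + 2) ∧ (∀ᶠ t in 𝓝 t₀, (q t).Splits) ∧
      (q t₀).coeff (n + 1) = 0 ∧ (q t₀).coeff n ≠ 0 ∧
      ∀ᶠ t in 𝓝 t₀, p t = (q t).scaleRoots ((t - t₀) ^ k) := by
  -- Since the roots sum to zero, this is the sum of their squares.
  have hS : AnalyticAt ℝ (fun t => -2 * (p t).coeff n) t₀ := analyticAt_const.fun_mul (hp n)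
  obtain ⟨k, g, hg, hg0, hSg⟩ := hS.exists_eq_even_pow_mul_of_nonneg
    (by
      filter_upwards [hs] with t ht
      have h := ht.sum_sq_roots (hm t) (hn t)
      rw [hc t] at h
      have h0 : 0 ≤ ((p t).roots.map (· ^ 2)).sum := by
        refine Multiset.sum_nonneg fun y hy => ?_
        obtain ⟨z, -, rfl⟩ := Multiset.mem_map.mp hy
        positivity
      linarith)
    (by
      intro h
      apply hne
      filter_upwards [h] with t ht
      linarith)
  -- From `g t < M ≤ M ^ 2`, every root is at most `M |t - t₀| ^ k` in absolute value. The `i`-th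
  -- coefficient is, up to sign, a symmetric function of degree `n + 2 - i` in the roots, whence its
  -- order of vanishing.
  set M : ℝ := g t₀ + 1 with hM
  have hM1 : 1 ≤ M := by linarith
  have hgM : ∀ᶠ t in 𝓝 t₀, g t < M := hg.continuousAt.eventually (gt_mem_nhds (by linarith))
  have hbound : ∀ i : Fin (n + 2), ∀ᶠ t in 𝓝 t₀,
      |(p t).coeff i| ≤ (M ^ (n + 2 - i.1) * (n + 2).choose i) * |t - t₀| ^ (k * (n + 2 - i)) := by
    intro i
    filter_upwards [hs, hSg, hgM] with t ht h1 h2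
    have hr : ∀ z ∈ (map (RingHom.id ℝ) (p t)).roots, ‖z‖ ≤ M * |t - t₀| ^ k := by
      intro z hz
      rw [map_id] at hz
      have h3 := ht.sq_le_of_mem_roots (hm t) (hn t) hz
      rw [hc t] at h3
      have h4 : z ^ 2 ≤ (M * |t - t₀| ^ k) ^ 2 := by
        calc z ^ 2 ≤ (t - t₀) ^ (2 * k) * g t := by linarith
          _ ≤ (t - t₀) ^ (2 * k) * M ^ 2 := by
            refine mul_le_mul_of_nonneg_left ?_ ?_
            · nlinarith
            · rw [pow_mul]; positivity
          _ = (M * |t - t₀| ^ k) ^ 2 := by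
            rw [mul_pow, ← pow_mul, mul_comm k 2, pow_mul |t - t₀|, sq_abs, pow_mul]
            ring
      exact abs_le_of_sq_le_sq h4 (by positivity)
    have h5 := coeff_le_of_roots_le (f := RingHom.id ℝ) i.1 (hm t) (by rwa [map_id]) hr
    rw [map_id, hn t, Real.norm_eq_abs, mul_pow, ← pow_mul] at h5
    calc _ ≤ _ := h5
      _ = _ := by ring
  choose b hb hpb using fun i : Fin (n + 2) => (hp i).exists_eq_pow_mul_of_abs_le (hbound i)
  let q : ℝ → ℝ[X] := fun t => monicOfFn (n + 2) fun i => b i t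
  have hqa : AnalyticCoeffs q t₀ := analyticCoeffs_monicOfFn hb
  have hqm : ∀ t, (q t).Monic := fun t => monic_monicOfFn _ _
  have hqn : ∀ t, (q t).natDegree = n + 2 := fun t => natDegree_monicOfFn _ _
  have hpq : ∀ᶠ t in 𝓝 t₀, p t = (q t).scaleRoots ((t - t₀) ^ k) := by
    filter_upwards [eventually_all.mpr hpb] with t ht
    refine (hm t).eq_of_toFn_eq ((monic_scaleRoots_iff _).mpr (hqm t)) (hn t)
      (by rw [natDegree_scaleRoots, hqn]) ?_
    ext i
    rw [toFn_apply, toFn_apply, coeff_scaleRoots, hqn, ht i, coeff_monicOfFn _ i.2, ← pow_mul,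
      mul_comm]
  have hqp : ∀ᶠ t in 𝓝[≠] t₀, q t = (p t).scaleRoots ((t - t₀) ^ k)⁻¹ := by
    filter_upwards [hpq.filter_mono nhdsWithin_le_nhds, self_mem_nhdsWithin] with t h1 h2
    rw [h1, ← scaleRoots_mul, mul_inv_cancel₀ (pow_ne_zero _ (sub_ne_zero.mpr h2)),
      scaleRoots_one]
  have hqs : ∀ᶠ t in 𝓝[≠] t₀, (q t).Splits := by
    filter_upwards [hqp, hs.filter_mono nhdsWithin_le_nhds] with t h1 h2
    rw [h1]
    exact h2.scaleRoots _
  -- The scaling factor may vanish at `t₀`, so facts about `q t₀` come from punctured neighbourhoods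
  -- by closedness or continuity.
  have hqs0 : (q t₀).Splits :=
    splits_of_eventually_splits (fun i => (hqa i).continuousAt) hqm hqn hqs
  have hcoeff1 : (fun t => (q t).coeff (n + 1)) =ᶠ[𝓝 t₀] fun _ => 0 := by
    rw [← (hqa _).continuousAt.eventuallyEq_nhds_iff_eventuallyEq_nhdsNE continuousAt_const]
    filter_upwards [hqp] with t h1
    rw [h1, coeff_scaleRoots, hc t, zero_mul]
  have hcoeff0 : (fun t => -2 * (q t).coeff n) =ᶠ[𝓝 t₀] g := by
    have hqc : ContinuousAt (fun t => -2 * (q t).coeff n) t₀ :=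
      continuousAt_const.mul (hqa n).continuousAt
    rw [← hqc.eventuallyEq_nhds_iff_eventuallyEq_nhdsNE hg.continuousAt]
    filter_upwards [hqp, hSg.filter_mono nhdsWithin_le_nhds, self_mem_nhdsWithin] with t h1 h2 h3
    have h4 : t - t₀ ≠ 0 := sub_ne_zero.mpr h3
    rw [h1, coeff_scaleRoots, hn t, show n + 2 - n = 2 by omega, ← mul_assoc, h2, inv_pow,
      ← pow_mul, mul_comm 2 k]
    field_simp
  refine ⟨k, q, hqa, hqm, hqn, ?_, hcoeff1.self_of_nhds, ?_, hpq⟩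
  · rw [eventually_nhdsWithin_iff] at hqs
    filter_upwards [hqs] with t ht
    by_cases h : t = t₀
    · rwa [h]
    · exact ht h
  · intro h
    have := hcoeff0.self_of_nhds
    simp only [h, mul_zero] at this
    linarith

/-- **Rellich's theorem** for polynomials: the roots of a one-parameter analytic family of
real-rooted monic polynomials can be chosen analytically. -/
theorem hasAnalyticRoots {p : ℝ → ℝ[X]} {t₀ : ℝ} {n : ℕ} (hp : AnalyticCoeffs p t₀)
    (hm : ∀ t, (p t).Monic) (hn : ∀ t, (p t).natDegree = n)
    (hs : ∀ᶠ t in 𝓝 t₀, (p t).Splits) : HasAnalyticRoots p t₀ := by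
  induction n using Nat.strong_induction_on generalizing p with
  | _ N ih =>
  rcases N with _ | _ | n
  · exact ⟨0, by simp, Eventually.of_forall fun t => by
      simpa using (hm t).natDegree_eq_zero.mp (hn t)⟩
  · refine ⟨{fun t => -(p t).coeff 0}, ?_, Eventually.of_forall fun t => ?_⟩
    · intro f hf
      rw [Multiset.mem_singleton.mp hf]
      exact (hp 0).fun_neg
    · have h := (p t).eq_X_add_C_of_natDegree_le_one (hn t).le
      have h1 : (p t).coeff 1 = 1 := by simpa [hn t] using (hm t).coeff_natDegree
      rw [h1, C_1, one_mul] at h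
      simpa using h
  have centered : ∀ p : ℝ → ℝ[X], AnalyticCoeffs p t₀ → (∀ t, (p t).Monic) →
      (∀ t, (p t).natDegree = n + 2) → (∀ᶠ t in 𝓝 t₀, (p t).Splits) →
      (∀ t, (p t).coeff (n + 1) = 0) → HasAnalyticRoots p t₀ := by
    intro p hp hm hn hs hc
    by_cases hz : ∀ᶠ t in 𝓝 t₀, (p t).coeff n = 0
    · refine ⟨Multiset.replicate (n + 2) fun _ => 0, ?_, ?_⟩
      · intro f hf
        rw [Multiset.eq_of_mem_replicate hf]
        exact analyticAt_const
      · filter_upwards [hz, hs] with t h1 h2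
        have hr : (p t).roots = Multiset.replicate (n + 2) 0 := by
          refine Multiset.eq_replicate.mpr ⟨by rw [← h2.natDegree_eq_card_roots, hn], ?_⟩
          intro x hx
          have := h2.sq_le_of_mem_roots (hm t) (hn t) hx
          rw [hc t, h1] at this
          nlinarith
        conv_lhs => rw [h2.eq_prod_roots_of_monic (hm t), hr]
        simp
    · obtain ⟨k, q, hqa, hqm, hqn, hqs, hq1, hq0, hpq⟩ := exists_eq_scaleRoots hp hm hn hs hc hz
      obtain ⟨F, G, hF, hG, hcop, hFG, hFn, hGn⟩ :=
        exists_isCoprime_factorization hqs.self_of_nhds (hqm t₀) (hqn t₀) hq1 hq0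
      have hadd : F.natDegree + G.natDegree = n + 2 := by
        rw [← hF.natDegree_mul hG, ← hFG, hqn]
      obtain ⟨f, g, hfa, hga, hfm, hgm, hfn, hgn, hfg⟩ :=
        exists_analyticCoeffs_factorization hqa hqm (fun t => (hqn t).trans hadd.symm) hF hG rfl rfl
          hcop hFG
      have hfs : ∀ᶠ t in 𝓝 t₀, (f t).Splits := by
        filter_upwards [hqs, hfg] with t h1 h2
        exact h1.of_dvd (hqm t).ne_zero ⟨g t, h2⟩
      have hgs : ∀ᶠ t in 𝓝 t₀, (g t).Splits := by
        filter_upwards [hqs, hfg] with t h1 h2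
        exact h1.of_dvd (hqm t).ne_zero ⟨f t, h2.trans (mul_comm _ _)⟩
      have hq := (ih _ hFn hfa hfm hfn hfs).of_mul (ih _ hGn hga hgm hgn hgs) hfg
      exact hq.of_scaleRoots (s := fun t => (t - t₀) ^ k) (by fun_prop) hpq
  -- The shift is by the mean of the roots, minus the subleading coefficient over the degree `n +
  -- 2`.
  have hcan : AnalyticAt ℝ (fun t => (p t).coeff (n + 1) * (-((n + 1 : ℕ) + 1 : ℝ)⁻¹)) t₀ :=
    (hp _).fun_mul analyticAt_const
  refine HasAnalyticRoots.of_taylor hcan (centered _ (hp.taylor hn hcan) ?_ ?_ ?_ ?_)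
  · intro t
    rw [Monic, leadingCoeff_taylor]
    exact hm t
  · intro t
    rw [natDegree_taylor, hn]
  · filter_upwards [hs] with t ht
    exact ht.taylor _
  · intro t
    rw [taylor_coeff_of_natDegree_eq_add_one (hm t) (hn t)]
    have : ((n + 1 : ℕ) + 1 : ℝ) ≠ 0 := by positivity
    field_simp
    ring

end Polynomial

/-! ### Smallest partial sums and reordering -/

/-- Compare with the threshold `c`, the `r`-th smallest value: `(l - c)(1 - w) ≤ 0` on the first `r`
indices and `(l - c) w ≥ 0` on the others. Since the weights total `r`, the terms in `c` cancel. -/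
theorem Fin.sum_castLE_le_sum_mul {n r : ℕ} (hr : 0 < r) (hrn : r ≤ n) {l : Fin n → ℝ}
    (hl : Monotone l) {w : Fin n → ℝ} (h0 : ∀ i, 0 ≤ w i) (h1 : ∀ i, w i ≤ 1)
    (hw : ∑ i, w i = r) : ∑ i : Fin r, l (Fin.castLE hrn i) ≤ ∑ i, l i * w i := by
  obtain ⟨m, rfl⟩ := Nat.exists_eq_add_of_le hrn
  set c : ℝ := l (Fin.castAdd m ⟨r - 1, by omega⟩) with hc
  rw [Fin.sum_univ_add] at hw ⊢
  have e1 : ∑ i : Fin r, (l (Fin.castAdd m i) - c) * (1 - w (Fin.castAdd m i)) ≤ 0 := by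
    refine Finset.sum_nonpos fun i _ => mul_nonpos_of_nonpos_of_nonneg ?_ (sub_nonneg.mpr (h1 _))
    refine sub_nonpos.mpr (hl ?_)
    rw [Fin.le_def]
    simp only [Fin.val_castAdd]
    omega
  have e2 : 0 ≤ ∑ i : Fin m, (l (Fin.natAdd r i) - c) * w (Fin.natAdd r i) := by
    refine Finset.sum_nonneg fun i _ => mul_nonneg ?_ (h0 _)
    refine sub_nonneg.mpr (hl ?_)
    rw [Fin.le_def]
    simp only [Fin.val_castAdd, Fin.val_natAdd]
    omega
  simp only [sub_mul, mul_sub, mul_one, Finset.sum_sub_distrib, ← Finset.mul_sum,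
    Finset.sum_const, Finset.card_univ, Fintype.card_fin, nsmul_eq_mul] at e1 e2
  have e3 : ∑ i : Fin r, l (Fin.castLE hrn i) = ∑ i : Fin r, l (Fin.castAdd m i) := rfl
  rw [e3]
  have e4 : c * (∑ i : Fin r, w (Fin.castAdd m i)) + c * (∑ i : Fin m, w (Fin.natAdd r i))
      = r * c := by rw [← mul_add, hw, mul_comm]
  linarith

theorem Fin.sum_castLE_le_sum {n r : ℕ} (hr : 0 < r) (hrn : r ≤ n) {l : Fin n → ℝ}
    (hl : Monotone l) {S : Finset (Fin n)} (hS : S.card = r) :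
    ∑ i : Fin r, l (Fin.castLE hrn i) ≤ ∑ i ∈ S, l i := by
  have h := Fin.sum_castLE_le_sum_mul hr hrn hl (w := fun i => if i ∈ S then 1 else 0)
    (fun i => by positivity) (fun i => by split_ifs <;> norm_num) (by simp [hS])
  simpa using h

theorem exists_perm_comp_eq_of_map_univ_eq {n : ℕ} {l m : Fin n → ℝ} (hl : Monotone l)
    (h : (Finset.univ.val.map m : Multiset ℝ) = Finset.univ.val.map l) :
    ∃ σ : Equiv.Perm (Fin n), m ∘ σ = l := by
  refine ⟨Tuple.sort m, List.ofFn_injective ?_⟩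
  rw [Fin.univ_val_map, Fin.univ_val_map, Multiset.coe_eq_coe] at h
  exact ((Equiv.Perm.ofFn_comp_perm _ _).trans h).eq_of_sortedLE
    (Tuple.monotone_sort m).sortedLE_ofFn hl.sortedLE_ofFn

/-! ### One-sided minima of analytic germs -/

/-- The difference is zero near `t₀` or equals `(t - t₀) ^ m * h t` with `h t₀ ≠ 0`; to the right of
`t₀` the sign of `h t₀` decides. -/
theorem AnalyticAt.eventually_le_or_le {f g : ℝ → ℝ} {t₀ : ℝ} (hf : AnalyticAt ℝ f t₀)
    (hg : AnalyticAt ℝ g t₀) :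
    (∀ᶠ t in 𝓝[≥] t₀, f t ≤ g t) ∨ ∀ᶠ t in 𝓝[≥] t₀, g t ≤ f t := by
  have hd := hg.fun_sub hf
  by_cases hz : ∀ᶠ t in 𝓝 t₀, g t - f t = 0
  · left
    filter_upwards [hz.filter_mono nhdsWithin_le_nhds] with t ht
    linarith
  · obtain ⟨m, h, hh, hh0, hm⟩ := hd.exists_eventuallyEq_pow_smul_nonzero_iff.mpr hz
    rcases lt_or_gt_of_ne hh0 with hneg | hpos
    · right
      filter_upwards [hm.filter_mono nhdsWithin_le_nhds, self_mem_nhdsWithin,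
        (hh.continuousAt.eventually (gt_mem_nhds hneg)).filter_mono nhdsWithin_le_nhds]
        with t h1 h2 h3
      have h4 : 0 ≤ (t - t₀) ^ m := pow_nonneg (sub_nonneg.mpr h2) m
      rw [smul_eq_mul] at h1
      linarith [mul_nonpos_of_nonneg_of_nonpos h4 h3.le]
    · left
      filter_upwards [hm.filter_mono nhdsWithin_le_nhds, self_mem_nhdsWithin,
        (hh.continuousAt.eventually (lt_mem_nhds hpos)).filter_mono nhdsWithin_le_nhds]
        with t h1 h2 h3
      have h4 : 0 ≤ (t - t₀) ^ m := pow_nonneg (sub_nonneg.mpr h2) m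
      rw [smul_eq_mul] at h1
      linarith [mul_nonneg h4 h3.le]

/-- Among finitely many analytic germs one is minimal to the right of the base point. -/
theorem Finset.exists_eventually_nhdsGE_le {ι : Type*} {s : Finset ι} (hs : s.Nonempty)
    {f : ι → ℝ → ℝ} {t₀ : ℝ} (hf : ∀ i ∈ s, AnalyticAt ℝ (f i) t₀) :
    ∃ i ∈ s, ∀ᶠ t in 𝓝[≥] t₀, ∀ j ∈ s, f i t ≤ f j t := by
  induction hs using Finset.Nonempty.cons_induction with
  | singleton a => exact ⟨a, by simp, by simp⟩
  | cons a s ha hs ih =>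
    obtain ⟨i, hi, hmin⟩ := ih fun j hj => hf j (Finset.mem_cons_of_mem hj)
    rcases (hf a (Finset.mem_cons_self a s)).eventually_le_or_le
      (hf i (Finset.mem_cons_of_mem hi)) with h | h
    · refine ⟨a, Finset.mem_cons_self a s, ?_⟩
      filter_upwards [h, hmin] with t h1 h2 j hj
      rcases Finset.mem_cons.mp hj with rfl | hj
      · exact le_rfl
      · exact h1.trans (h2 j hj)
    · refine ⟨i, Finset.mem_cons_of_mem hi, ?_⟩
      filter_upwards [h, hmin] with t h1 h2 j hj
      rcases Finset.mem_cons.mp hj with rfl | hj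
      · exact h1
      · exact h2 j hj

/-- Reflection in `t₀` transfers the right-sided minimum to the left side. -/
theorem tendsto_const_sub_nhdsLE_nhdsGE (t₀ : ℝ) :
    Tendsto (fun t => 2 * t₀ - t) (𝓝[≤] t₀) (𝓝[≥] t₀) := by
  refine tendsto_nhdsWithin_of_tendsto_nhds_of_eventually_within _ ?_ ?_
  · have h : Continuous fun t : ℝ => 2 * t₀ - t := by fun_prop
    have h1 := h.tendsto t₀
    rw [show 2 * t₀ - t₀ = t₀ by ring] at h1
    exact h1.mono_left nhdsWithin_le_nhds
  · filter_upwards [self_mem_nhdsWithin] with t ht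
    simp only [Set.mem_Iic] at ht
    simp only [Set.mem_Ici]
    linarith

theorem Finset.exists_eventually_nhdsLE_le {ι : Type*} {s : Finset ι} (hs : s.Nonempty)
    {f : ι → ℝ → ℝ} {t₀ : ℝ} (hf : ∀ i ∈ s, AnalyticAt ℝ (f i) t₀) :
    ∃ i ∈ s, ∀ᶠ t in 𝓝[≤] t₀, ∀ j ∈ s, f i t ≤ f j t := by
  obtain ⟨i, hi, h⟩ := Finset.exists_eventually_nhdsGE_le hs
    (f := fun i t => f i (2 * t₀ - t)) (t₀ := t₀) fun i hi => by
      refine AnalyticAt.fun_comp (g := f i) (f := fun t => 2 * t₀ - t) ?_ (by fun_prop)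
      rw [show 2 * t₀ - t₀ = t₀ by ring]
      exact hf i hi
  refine ⟨i, hi, ?_⟩
  filter_upwards [(tendsto_const_sub_nhdsLE_nhdsGE t₀).eventually h] with t ht j hj
  simpa using ht j hj

theorem exists_contDiffOn_Icc_right {φ F : ℝ → ℝ} {t₀ : ℝ} (hF : AnalyticAt ℝ F t₀)
    (h : ∀ᶠ t in 𝓝[≥] t₀, φ t = F t) :
    ∃ ε > 0, ContDiffOn ℝ ((⊤ : ℕ∞) : WithTop ℕ∞) φ (Set.Icc t₀ (t₀ + ε)) := by
  obtain ⟨u, hu, hsub⟩ := mem_nhdsGE_iff_exists_Icc_subset.mp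
    (h.and (hF.eventually_analyticAt.filter_mono nhdsWithin_le_nhds))
  refine ⟨u - t₀, sub_pos.mpr hu, ?_⟩
  rw [add_sub_cancel]
  exact ContDiffOn.congr (fun t ht => (hsub ht).2.contDiffAt.contDiffWithinAt)
    fun t ht => (hsub ht).1

theorem exists_contDiffOn_Icc_left {φ F : ℝ → ℝ} {t₀ : ℝ} (hF : AnalyticAt ℝ F t₀)
    (h : ∀ᶠ t in 𝓝[≤] t₀, φ t = F t) :
    ∃ ε > 0, ContDiffOn ℝ ((⊤ : ℕ∞) : WithTop ℕ∞) φ (Set.Icc (t₀ - ε) t₀) := by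
  obtain ⟨u, hu, hsub⟩ := mem_nhdsLE_iff_exists_Icc_subset.mp
    (h.and (hF.eventually_analyticAt.filter_mono nhdsWithin_le_nhds))
  refine ⟨t₀ - u, sub_pos.mpr hu, ?_⟩
  rw [sub_sub_cancel]
  exact ContDiffOn.congr (fun t ht => (hsub ht).2.contDiffAt.contDiffWithinAt)
    fun t ht => (hsub ht).1

/-! ### From local to global piecewise smoothness -/

namespace FairPCA

theorem PiecewiseSmoothOn.refl (f : ℝ → ℝ) (a : ℝ) : PiecewiseSmoothOn f a a :=
  ⟨0, fun _ => a, fun i j hij => absurd hij (by omega), rfl, rfl, fun i => i.elim0⟩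

theorem PiecewiseSmoothOn.extend {f : ℝ → ℝ} {a b c : ℝ} (h : PiecewiseSmoothOn f a b)
    (hbc : b < c) (hf : ContDiffOn ℝ ((⊤ : ℕ∞) : WithTop ℕ∞) f (Set.Icc b c)) :
    PiecewiseSmoothOn f a c := by
  obtain ⟨k, p, hp, h0, hk, hs⟩ := h
  refine ⟨k + 1, Fin.snoc p c, ?_, ?_, ?_, ?_⟩
  · refine Fin.strictMono_iff_lt_succ.mpr fun i => ?_
    refine Fin.lastCases ?_ (fun j => ?_) i
    · rw [Fin.succ_last, Fin.snoc_last, Fin.snoc_castSucc, hk]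
      exact hbc
    · rw [Fin.succ_castSucc, Fin.snoc_castSucc, Fin.snoc_castSucc]
      exact hp Fin.castSucc_lt_succ
  · rw [← Fin.castSucc_zero, Fin.snoc_castSucc, h0]
  · rw [Fin.snoc_last]
  · intro i
    refine Fin.lastCases ?_ (fun j => ?_) i
    · rw [Fin.succ_last, Fin.snoc_last, Fin.snoc_castSucc, hk]
      exact hf
    · rw [Fin.succ_castSucc, Fin.snoc_castSucc, Fin.snoc_castSucc]
      exact hs j

/-- A function that is smooth on a one-sided closed neighbourhood of each point, on both sides,
is piecewise smooth on every compact interval. -/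
theorem piecewiseSmoothOn_of_local {f : ℝ → ℝ} {a b : ℝ} (hab : a ≤ b)
    (hr : ∀ t, ∃ ε > 0, ContDiffOn ℝ ((⊤ : ℕ∞) : WithTop ℕ∞) f (Set.Icc t (t + ε)))
    (hl : ∀ t, ∃ ε > 0, ContDiffOn ℝ ((⊤ : ℕ∞) : WithTop ℕ∞) f (Set.Icc (t - ε) t)) :
    PiecewiseSmoothOn f a b := by
  set S : Set ℝ := {x | a ≤ x ∧ x ≤ b ∧ PiecewiseSmoothOn f a x} with hS
  have haS : a ∈ S := ⟨le_rfl, hab, .refl f a⟩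
  have hbdd : BddAbove S := ⟨b, fun x hx => hx.2.1⟩
  set x := sSup S with hx
  have hax : a ≤ x := le_csSup hbdd haS
  have hxb : x ≤ b := csSup_le ⟨a, haS⟩ fun y hy => hy.2.1
  -- Smoothness to the left of the supremum shows that it is attained; smoothness to its right would
  -- push past it unless `x = b`.
  have hxS : PiecewiseSmoothOn f a x := by
    obtain ⟨ε, hε, hf⟩ := hl x
    obtain ⟨y, hy, hlt⟩ := exists_lt_of_lt_csSup ⟨a, haS⟩ (show x - ε < sSup S by linarith)
    rcases (le_csSup hbdd hy).eq_or_lt with h | h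
    · rw [hx, ← h]
      exact hy.2.2
    · exact hy.2.2.extend h (hf.mono (Set.Icc_subset_Icc_left hlt.le))
  rcases hxb.eq_or_lt with h | h
  · rwa [← h]
  · exfalso
    obtain ⟨ε, hε, hf⟩ := hr x
    have hlt : x < min b (x + ε) := lt_min h (by linarith)
    have hmem : min b (x + ε) ∈ S :=
      ⟨hax.trans hlt.le, min_le_left _ _,
        hxS.extend hlt (hf.mono (Set.Icc_subset_Icc_right (min_le_right _ _)))⟩
    exact absurd (le_csSup hbdd hmem) (not_le.mpr hlt)

/-! ### Ordered eigenvalues and the Ky Fan inequality -/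

section Eigenvalues

variable {n : ℕ} {M : Matrix (Fin n) (Fin n) ℝ} (hM : M.IsHermitian)

theorem eigenvalueAsc_monotone : Monotone (eigenvalueAsc hM) := by
  intro i j hij
  refine hM.eigenvalues₀_antitone ?_
  have h : i.1 ≤ j.1 := hij
  rw [Fin.le_def]
  simp only [Fin.val_cast, Fin.val_rev]
  omega

/-- The order-reversing relabelling between the two index types of eigenvalues. -/
def ascEquiv (n : ℕ) : Fin n ≃ Fin (Fintype.card (Fin n)) :=
  Fin.revPerm.trans (finCongr (Fintype.card_fin n).symm)

theorem roots_charpoly_eq_eigenvalueAsc :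
    M.charpoly.roots = Finset.univ.val.map (eigenvalueAsc hM) := by
  rw [hM.roots_charpoly_eq_eigenvalues₀]
  have h : (Finset.univ : Finset (Fin (Fintype.card (Fin n)))).val
      = (Finset.univ : Finset (Fin n)).val.map (ascEquiv n) := by
    rw [← Finset.map_univ_equiv (ascEquiv n), Finset.map_val]
    rfl
  rw [h, Multiset.map_map]
  rfl

/-- An orthonormal eigenbasis ordered by increasing eigenvalue. -/
noncomputable def eigenbasisAsc : OrthonormalBasis (Fin n) ℝ (EuclideanSpace ℝ (Fin n)) :=
  ((Matrix.isSymmetric_toEuclideanLin_iff.mpr hM).eigenvectorBasis finrank_euclideanSpace).reindex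
    (ascEquiv n).symm

theorem toEuclideanLin_eigenbasisAsc (i : Fin n) :
    Matrix.toEuclideanLin M (eigenbasisAsc hM i) = eigenvalueAsc hM i • eigenbasisAsc hM i := by
  have h := (Matrix.isSymmetric_toEuclideanLin_iff.mpr hM).apply_eigenvectorBasis
    finrank_euclideanSpace (ascEquiv n i)
  rw [eigenbasisAsc, OrthonormalBasis.reindex_apply, Equiv.symm_symm]
  exact h

theorem inner_toEuclideanLin_self (v : EuclideanSpace ℝ (Fin n)) :
    inner ℝ v (Matrix.toEuclideanLin M v)
      = ∑ i, eigenvalueAsc hM i * inner ℝ v (eigenbasisAsc hM i) ^ 2 := by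
  rw [← (eigenbasisAsc hM).sum_inner_mul_inner]
  refine Finset.sum_congr rfl fun i _ => ?_
  rw [← Matrix.isSymmetric_toEuclideanLin_iff.mpr hM, toEuclideanLin_eigenbasisAsc,
    real_inner_smul_left, real_inner_comm v]
  ring

/-- The **Ky Fan inequality**: the sum of the `r` smallest eigenvalues is a lower bound for the
trace of the compression to an `r`-dimensional subspace. -/
theorem sum_eigenvalueAsc_le {r : ℕ} (hr : 0 < r) (hrn : r ≤ n)
    {v : Fin r → EuclideanSpace ℝ (Fin n)} (hv : Orthonormal ℝ v) :
    ∑ i : Fin r, eigenvalueAsc hM (Fin.castLE hrn i)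
      ≤ ∑ j, inner ℝ (v j) (Matrix.toEuclideanLin M (v j)) := by
  -- The weight of `e_i` is the squared length of its projection to the span of `v`: at most `1` by
  -- Bessel, with total `r` by Parseval.
  have h := Fin.sum_castLE_le_sum_mul hr hrn (eigenvalueAsc_monotone hM)
    (w := fun i => ∑ j, inner ℝ (v j) (eigenbasisAsc hM i) ^ 2)
    (fun i => Finset.sum_nonneg fun j _ => sq_nonneg _)
    (fun i => by
      have := hv.sum_inner_products_le (eigenbasisAsc hM i) (s := Finset.univ)
      simpa using this)
    (by
      rw [Finset.sum_comm]
      have h1 : ∀ j, ∑ i, inner ℝ (v j) (eigenbasisAsc hM i) ^ 2 = 1 := fun j => by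
        have := (eigenbasisAsc hM).sum_inner_mul_inner (v j) (v j)
        rw [real_inner_self_eq_norm_sq, hv.1 j, one_pow] at this
        rw [← this]
        refine Finset.sum_congr rfl fun i _ => ?_
        rw [real_inner_comm (v j), sq]
      simp [h1])
  refine h.trans_eq ?_
  simp only [inner_toEuclideanLin_self hM, Finset.mul_sum]
  exact Finset.sum_comm

theorem sum_inner_eigenbasisAsc {r : ℕ} (hrn : r ≤ n) :
    ∑ j : Fin r, inner ℝ (eigenbasisAsc hM (Fin.castLE hrn j))
        (Matrix.toEuclideanLin M (eigenbasisAsc hM (Fin.castLE hrn j)))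
      = ∑ i : Fin r, eigenvalueAsc hM (Fin.castLE hrn i) := by
  refine Finset.sum_congr rfl fun i _ => ?_
  rw [toEuclideanLin_eigenbasisAsc, real_inner_smul_right, real_inner_self_eq_norm_sq,
    (eigenbasisAsc hM).orthonormal.1, one_pow, mul_one]

end Eigenvalues

/-! ### Concavity and piecewise smoothness of `phi` -/

variable {m₁ m₂ n r : ℕ}

/-- The frame of lowest eigenvectors at `a x + b y` gives equality there and is a competitor in Ky
Fan's inequality at `x` and at `y`. -/
theorem phi_concaveOn_univ (hr : 0 < r) (hrn : r ≤ n) (A : Matrix (Fin m₁) (Fin n) ℝ)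
    (B : Matrix (Fin m₂) (Fin n) ℝ) : ConcaveOn ℝ Set.univ (phi hrn A B) := by
  refine ⟨convex_univ, fun x _ y _ a b ha hb hab => ?_⟩
  simp only [smul_eq_mul]
  have hfam : matrixFamily r A B (a * x + b * y)
      = a • matrixFamily r A B x + b • matrixFamily r A B y := by
    obtain rfl : b = 1 - a := by linarith
    unfold matrixFamily
    module
  have hM := matrixFamily_isHermitian r A B (a * x + b * y)
  set v : Fin r → EuclideanSpace ℝ (Fin n) := fun j => eigenbasisAsc hM (Fin.castLE hrn j)
  have hv : Orthonormal ℝ v :=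
    (eigenbasisAsc hM).orthonormal.comp _ (Fin.castLE_injective hrn)
  have h1 := sum_eigenvalueAsc_le (matrixFamily_isHermitian r A B x) hr hrn hv
  have h2 := sum_eigenvalueAsc_le (matrixFamily_isHermitian r A B y) hr hrn hv
  have h3 : phi hrn A B (a * x + b * y)
      = ∑ j, inner ℝ (v j) (Matrix.toEuclideanLin (matrixFamily r A B (a * x + b * y)) (v j)) :=
    (sum_inner_eigenbasisAsc hM hrn).symm
  rw [h3, hfam]
  simp only [map_add, map_smul, LinearMap.add_apply, LinearMap.smul_apply, inner_add_right,
    real_inner_smul_right, Finset.sum_add_distrib, ← Finset.mul_sum]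
  exact add_le_add (mul_le_mul_of_nonneg_left h1 ha) (mul_le_mul_of_nonneg_left h2 hb)

theorem analyticCoeffs_charpoly_matrixFamily (r : ℕ) (A : Matrix (Fin m₁) (Fin n) ℝ)
    (B : Matrix (Fin m₂) (Fin n) ℝ) (t₀ : ℝ) :
    AnalyticCoeffs (fun t => (matrixFamily r A B t).charpoly) t₀ := by
  simp only [Matrix.charpoly, Matrix.det_apply']
  refine .sum _ fun σ _ => (AnalyticCoeffs.const _).mul (.prod _ fun i _ => ?_)
  simp only [Matrix.charmatrix_apply]
  refine (AnalyticCoeffs.const _).sub (.C ?_)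
  simp only [matrixFamily, Matrix.add_apply, Matrix.smul_apply, smul_eq_mul]
  fun_prop

/-- The permutation depends on `t`, because the analytic branches may cross at `t₀`. -/
theorem exists_analyticAt_eigenvalues (r : ℕ) (A : Matrix (Fin m₁) (Fin n) ℝ)
    (B : Matrix (Fin m₂) (Fin n) ℝ) (t₀ : ℝ) :
    ∃ μ : Fin n → ℝ → ℝ, (∀ i, AnalyticAt ℝ (μ i) t₀) ∧ ∀ᶠ t in 𝓝 t₀,
      ∃ σ : Equiv.Perm (Fin n),
        ∀ i, μ (σ i) t = eigenvalueAsc (matrixFamily_isHermitian r A B t) i := by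
  obtain ⟨L, hL, hpL⟩ := hasAnalyticRoots (analyticCoeffs_charpoly_matrixFamily r A B t₀)
    (fun t => Matrix.charpoly_monic _)
    (fun t => (Matrix.charpoly_natDegree_eq_dim _).trans (Fintype.card_fin n))
    (Eventually.of_forall fun t => (matrixFamily_isHermitian r A B t).splits_charpoly)
  have hroots : ∀ᶠ t in 𝓝 t₀, L.map (fun f => f t)
      = Finset.univ.val.map (eigenvalueAsc (matrixFamily_isHermitian r A B t)) := by
    filter_upwards [hpL] with t ht
    rw [← roots_charpoly_eq_eigenvalueAsc, ht, roots_multiset_prod_X_sub_C]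
  have hcard : L.toList.length = n := by
    obtain ⟨t, ht⟩ := hroots.exists
    simpa using congrArg Multiset.card ht
  subst hcard
  refine ⟨L.toList.get, fun i => hL _ (Multiset.mem_toList.mp (List.get_mem _ _)), ?_⟩
  filter_upwards [hroots] with t ht
  obtain ⟨σ, hσ⟩ := exists_perm_comp_eq_of_map_univ_eq (m := fun i => L.toList.get i t)
    (eigenvalueAsc_monotone (matrixFamily_isHermitian r A B t)) (by
      rw [← ht]
      conv_rhs => rw [← Multiset.coe_toList L]
      rw [Fin.univ_val_map, Multiset.map_coe]
      congr 1
      apply List.ext_get <;> simp)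
  exact ⟨σ, fun i => congrFun hσ i⟩

/-- Near each point `phi` is the minimum of finitely many analytic functions. -/
theorem exists_analyticAt_phi_eq_min (hr : 0 < r) (hrn : r ≤ n) (A : Matrix (Fin m₁) (Fin n) ℝ)
    (B : Matrix (Fin m₂) (Fin n) ℝ) (t₀ : ℝ) :
    ∃ (s : Finset (Finset (Fin n))) (f : Finset (Fin n) → ℝ → ℝ), s.Nonempty ∧
      (∀ S ∈ s, AnalyticAt ℝ (f S) t₀) ∧
      ∀ᶠ t in 𝓝 t₀, (∀ S ∈ s, phi hrn A B t ≤ f S t) ∧ ∃ S ∈ s, f S t ≤ phi hrn A B t := by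
  obtain ⟨μ, hμ, hσ⟩ := exists_analyticAt_eigenvalues r A B t₀
  -- The competitors are the sums over all `r`-element sets of branches; the minimum is attained by
  -- the set carrying the `r` smallest eigenvalues at `t`.
  refine ⟨Finset.univ.powersetCard r, fun S t => ∑ i ∈ S, μ i t, ?_, ?_, ?_⟩
  · exact Finset.powersetCard_nonempty.mpr (by simpa using hrn)
  · exact fun S _ => Finset.analyticAt_fun_sum _ fun i _ => hμ i
  · filter_upwards [hσ] with t ⟨σ, h⟩
    have hmono := eigenvalueAsc_monotone (matrixFamily_isHermitian r A B t)
    constructor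
    · intro S hS
      have hS' : (S.map σ.symm.toEmbedding).card = r := by
        rw [Finset.card_map, (Finset.mem_powersetCard.mp hS).2]
      refine (Fin.sum_castLE_le_sum hr hrn hmono hS').trans_eq ?_
      rw [Finset.sum_map]
      refine Finset.sum_congr rfl fun i _ => ?_
      rw [← h]
      simp
    · refine ⟨Finset.univ.map ((Fin.castLEEmb hrn).trans σ.toEmbedding), ?_, ?_⟩
      · simp [Finset.mem_powersetCard]
      · rw [Finset.sum_map]
        refine (Finset.sum_congr rfl fun i _ => ?_).le
        exact h _

theorem phi_piecewiseSmoothOn (hr : 0 < r) (hrn : r ≤ n) (A : Matrix (Fin m₁) (Fin n) ℝ)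
    (B : Matrix (Fin m₂) (Fin n) ℝ) : PiecewiseSmoothOn (phi hrn A B) 0 1 := by
  refine piecewiseSmoothOn_of_local zero_le_one (fun t₀ => ?_) fun t₀ => ?_
  · obtain ⟨s, f, hs, hf, h⟩ := exists_analyticAt_phi_eq_min hr hrn A B t₀
    obtain ⟨S, hS, hmin⟩ := Finset.exists_eventually_nhdsGE_le hs hf
    refine exists_contDiffOn_Icc_right (hf S hS) ?_
    filter_upwards [h.filter_mono nhdsWithin_le_nhds, hmin] with t ⟨h1, T, hT, h2⟩ h3
    exact le_antisymm (h1 S hS) ((h3 T hT).trans h2)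
  · obtain ⟨s, f, hs, hf, h⟩ := exists_analyticAt_phi_eq_min hr hrn A B t₀
    obtain ⟨S, hS, hmin⟩ := Finset.exists_eventually_nhdsLE_le hs hf
    refine exists_contDiffOn_Icc_left (hf S hS) ?_
    filter_upwards [h.filter_mono nhdsWithin_le_nhds, hmin] with t ⟨h1, T, hT, h2⟩ h3
    exact le_antisymm (h1 S hS) ((h3 T hT).trans h2)

end FairPCA

theorem lemma4p2 {m₁ m₂ n r : ℕ} (hm₁ : 0 < m₁) (hm₂ : 0 < m₂) (hr : 0 < r) (hrn : r ≤ n)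
    (A : Matrix (Fin m₁) (Fin n) ℝ) (B : Matrix (Fin m₂) (Fin n) ℝ) :
    ContinuousOn (FairPCA.phi hrn A B) (Set.Icc 0 1) ∧
      FairPCA.PiecewiseSmoothOn (FairPCA.phi hrn A B) 0 1 ∧
      ConcaveOn ℝ (Set.Icc 0 1) (FairPCA.phi hrn A B) := by
  have hconc := FairPCA.phi_concaveOn_univ hr hrn A B
  -- Concavity on `[0, 1]` alone would not give continuity at the end points; concavity on the open
  -- set `ℝ` does.
  exact ⟨(hconc.continuousOn isOpen_univ).mono (Set.subset_univ _),
    FairPCA.phi_piecewiseSmoothOn hr hrn A B,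
    hconc.subset (Set.subset_univ _) (convex_Icc 0 1)⟩
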